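/- Let $G$ be a finite group, let $r\in\mathbb Z$, and let $X,X'$ be $G$-modules such that $(X,X')$ is an $r$-encoding pair, i.e. for some $i\in\mathbb Z$ there is a natural isomorphism $\widehat H^i(G,\operatorname{Hom}_{\mathbb Z}(X,-))\simeq\widehat H^{i+r}(G,\operatorname{Hom}_{\mathbb Z}(X',-))$ of functors from $G$-modules to abelian groups, where $\widehat H^\bullet$ denotes Tate cohomology. Cup products of classes with coefficients in $\operatorname{Hom}$-modules are taken with respect to the composition maps $\operatorname{Hom}_{\mathbb Z}(Y,Z)\otimes_{\mathbb Z}\operatorname{Hom}_{\mathbb Z}(W,Y)\to\operatorname{Hom}_{\mathbb Z}(W,Z)$, $f\otimes\varphi\mapsto f\circ\varphi$. Put $R=\widehat H^0(G,\operatorname{Hom}_{\mathbb Z}(X,X))$, a ring under the cup product with identity $[\operatorname{id}_X]$, and $M=\widehat H^r(G,\operatorname{Hom}_{\mathbb Z}(X',X))$, on which $R$ acts on the left by cup product. An element $x\in M$ is called an encoding element if there is $x'\in\widehat H^{-r}(G,\operatorname{Hom}_{\mathbb Z}(X,X'))$ with $x'\cup x=[\operatorname{id}_{X'}]$ and $x\cup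 x'=[\operatorname{id}_X]$. Then: (a) for any two encoding elements $x,y\in M$ there is a unique $[\varphi]\in R^\times$ such that $y=[\varphi]\cup x$; (b) for any encoding element $x\in M$ and any $[\varphi]\in R^\times$, the element $y=[\varphi]\cup x$ is an encoding element. -/

import Mathlib

namespace Tate

open CategoryTheory

universe u

variable {k G : Type u} [CommRing k] [Group G]

/-- The `G`-module of functions `G → A` with `(g f)(x) = g (f (g⁻¹ x))`. For finite `G` this is the
induced module `Hom_k(k[G], A) ≅ k[G] ⊗ A` with diagonal action. -/
def funRep (A : Rep.{u} k G) : Representation k G (G → A) where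
  toFun g :=
    { toFun f x := A.ρ g (f (g⁻¹ * x))
      map_add' _ _ := by ext; simp
      map_smul' _ _ := by ext; simp }
  map_one' := by ext; simp
  map_mul' g h := by
    refine LinearMap.ext fun f => funext fun x => ?_
    simp [mul_assoc]

@[simp] lemma funRep_apply (A : Rep.{u} k G) (g : G) (f : G → A) (x : G) :
    funRep A g f x = A.ρ g (f (g⁻¹ * x)) := rfl

/-- `funRep A` as an object of the category of `G`-modules. -/
abbrev ind (A : Rep.{u} k G) : Rep.{u} k G := Rep.of (funRep A)

/-- The inclusion of `A` into `ind A` as constant functions. -/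
def const (A : Rep.{u} k G) : A ⟶ ind A :=
  Rep.ofHom (σ := funRep A) (ρ := A.ρ)
    ⟨LinearMap.pi fun _ => LinearMap.id, fun g => by ext; simp⟩

@[simp] lemma const_apply (A : Rep.{u} k G) (a : A) (x : G) :
    ((const A).hom a : G → A) x = a := rfl


lemma shortExact_of {S : ShortComplex (Rep.{u} k G)} (hf : Function.Injective S.f.hom)
    (hg : Function.Surjective S.g.hom)
    (h : ∀ x : S.X₂, S.g.hom x = 0 → ∃ y : S.X₁, S.f.hom y = x) : S.ShortExact where
  mono_f := (Rep.mono_iff_injective _).2 hf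
  epi_g := (Rep.epi_iff_surjective _).2 hg
  exact := by
    apply (forget₂ (Rep.{u} k G) (ModuleCat k)).reflects_exact_of_faithful
    exact (ShortComplex.moduleCat_exact_iff _).2 h

/-- The cokernel of the inclusion of constant functions: `0 → A → ind A → up A → 0`. -/
abbrev up (A : Rep.{u} k G) : Rep.{u} k G :=
  (ind A).quotient (LinearMap.range (const A).hom.toLinearMap) (by
    rintro g _ ⟨a, rfl⟩
    refine ⟨A.ρ g a, funext fun x => ?_⟩
    rfl)

/-- The short exact sequence `0 → A → ind A → up A → 0`. -/
def upSeq (A : Rep.{u} k G) : ShortComplex (Rep.{u} k G) where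
  X₁ := A
  X₂ := ind A
  X₃ := up A
  f := const A
  g := (ind A).mkQ _ _
  zero := by
    ext a
    exact (Submodule.Quotient.mk_eq_zero _).2 ⟨a, rfl⟩

lemma upSeq_exact (A : Rep.{u} k G) : (upSeq A).ShortExact := shortExact_of
  (fun a b h => congrFun (h : (fun _ : G => a) = fun _ : G => b) 1)
  (Submodule.mkQ_surjective _)
  (fun _ hx => (Submodule.Quotient.mk_eq_zero _).1 hx)

lemma contractNth_zero_cons {n : ℕ} (a : G) (g : Fin (n + 1) → G) :
    Fin.contractNth 0 (· * ·) (Fin.cons a g : Fin (n + 2) → G) =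
      Fin.cons (a * g 0) (fun i => g i.succ) := by
  funext i
  induction i using Fin.cases <;> simp [Fin.contractNth]

lemma contractNth_succ_cons {n : ℕ} (a : G) (g : Fin (n + 1) → G) (j : Fin (n + 1)) :
    Fin.contractNth j.succ (· * ·) (Fin.cons a g : Fin (n + 2) → G) =
      Fin.cons a (Fin.contractNth j (· * ·) g) := by
  funext i
  induction i using Fin.cases <;> simp [Fin.contractNth]

variable [Fintype G]

/-- The summation map from `ind A` onto `A`. -/
def total (A : Rep.{u} k G) : ind A ⟶ A :=
  Rep.ofHom (σ := A.ρ) (ρ := funRep A)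
    ⟨∑ x : G, LinearMap.proj x, fun g => by
      refine LinearMap.ext fun f => ?_
      simpa using Fintype.sum_equiv (Equiv.mulLeft g⁻¹) _ _ (fun x => by simp)⟩

@[simp] lemma total_apply (A : Rep.{u} k G) (f : G → A) :
    (total A).hom f = ∑ x, f x := by
  simp [total]

/-- The kernel of summation: `0 → down A → ind A → A → 0`. -/
abbrev down (A : Rep.{u} k G) : Rep.{u} k G :=
  (ind A).subrepresentation (LinearMap.ker (total A).hom.toLinearMap) (by
    intro g f hf
    have h := Rep.hom_comm_apply (total A) g f
    have hf' : (total A).hom f = 0 := hf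
    rw [hf', map_zero] at h
    exact h)

/-- The short exact sequence `0 → down A → ind A → A → 0`. -/
def downSeq (A : Rep.{u} k G) : ShortComplex (Rep.{u} k G) where
  X₁ := down A
  X₂ := ind A
  X₃ := A
  f := (ind A).subtype _ _
  g := total A
  zero := by
    ext a
    exact a.2

lemma downSeq_exact (A : Rep.{u} k G) : (downSeq A).ShortExact := shortExact_of
  Subtype.val_injective
  (fun a => ⟨by classical exact Pi.single (1 : G) a, by
    classical
    exact (total_apply A (Pi.single (1 : G) (a : A))).trans (Fintype.sum_pi_single' _ _)⟩)
  (fun x hx => ⟨⟨x, hx⟩, rfl⟩)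


section Vanishing

open groupCohomology groupHomology


variable {M : Rep.{u} k G} {θ : M →ₗ[k] M}

lemma exists_cochain (hθ : ∀ m, ∑ s : G, M.ρ s (θ (M.ρ s⁻¹ m)) = m)
    (n : ℕ) (f : (Fin (n + 1) → G) → M)
    (hf : inhomogeneousCochains.d M (n + 1) f = 0) :
    ∃ h : (Fin n → G) → M, inhomogeneousCochains.d M n h = f := by
  refine ⟨fun g => ∑ s : G, M.ρ s (θ (f (Fin.cons s⁻¹ g))), funext fun g => ?_⟩
  have key : ∀ s : G, M.ρ s (θ (M.ρ s⁻¹ (f g))) =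
      M.ρ s (θ (f (Fin.cons (s⁻¹ * g 0) (fun i => g i.succ)))) +
      ∑ j : Fin (n + 1), (-1 : k) ^ ((j : ℕ) + 1) •
        M.ρ s (θ (f (Fin.cons s⁻¹ (Fin.contractNth j (· * ·) g)))) := by
    intro s
    have h : inhomogeneousCochains.d M (n + 1) f (Fin.cons s⁻¹ g) = (0 : M) := congrFun hf _
    rw [inhomogeneousCochains.d_hom_apply, Fin.sum_univ_succ] at h
    simp only [contractNth_zero_cons, contractNth_succ_cons, Fin.cons_zero, Fin.cons_succ,
      Fin.val_zero, Fin.val_succ] at h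
    have h' := congrArg (fun m => M.ρ s (θ m)) h
    simp only [map_add, map_sum, map_smul, map_zero, pow_succ _ (_ + 1), zero_add, pow_one,
      mul_neg, mul_one, neg_smul, one_smul, map_neg, Finset.sum_neg_distrib] at h' ⊢
    rw [← sub_eq_zero, ← h']
    abel
  rw [inhomogeneousCochains.d_hom_apply, ← hθ (f g), Finset.sum_congr rfl fun s _ => key s,
    Finset.sum_add_distrib, Finset.sum_comm, map_sum]
  simp only [Finset.smul_sum]
  congr 1
  exact Fintype.sum_equiv (Equiv.mulLeft (g 0)) _ _ fun s => by simp

lemma exists_chain (hθ : ∀ m, ∑ s : G, M.ρ s (θ (M.ρ s⁻¹ m)) = m)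
    (n : ℕ) (f : (Fin (n + 1) → G) →₀ M)
    (hf : inhomogeneousChains.d M n f = 0) :
    ∃ h : (Fin (n + 2) → G) →₀ M, inhomogeneousChains.d M (n + 1) h = f := by
  let h (n : ℕ) : ((Fin n → G) →₀ M) →ₗ[k] ((Fin (n + 1) → G) →₀ M) :=
    Finsupp.lsum k fun g => ∑ s : G, Finsupp.lsingle (Fin.cons s g) ∘ₗ θ ∘ₗ M.ρ s
  have hs (n : ℕ) (g : Fin n → G) (m : M) : h n (Finsupp.single g m) =
      ∑ s : G, Finsupp.single (Fin.cons s g) (θ (M.ρ s m)) := by simp [h]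
  have key (f : (Fin (n + 1) → G) →₀ M) : inhomogeneousChains.d M (n + 1) (h (n + 1) f) +
      h n (inhomogeneousChains.d M n f) = f := by
    induction f using Finsupp.induction_linear with
    | zero => simp
    | add f g hf hg => 
      rw [map_add, map_add, map_add, map_add, add_add_add_comm, hf, hg]
    | single g m =>
      have h1 (s : G) : inhomogeneousChains.d M (n + 1)
          (Finsupp.single (Fin.cons s g) (θ (M.ρ s m))) =
          Finsupp.single g (M.ρ s⁻¹ (θ (M.ρ s m))) -
          Finsupp.single (Fin.cons (s * g 0) fun i => g i.succ) (θ (M.ρ s m)) -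
          ∑ j : Fin (n + 1), (-1 : k) ^ ((j : ℕ) + 1) •
            Finsupp.single (Fin.cons s (Fin.contractNth j (· * ·) g)) (θ (M.ρ s m)) := by
        rw [inhomogeneousChains.d_single, Fin.sum_univ_succ]
        simp only [contractNth_zero_cons, contractNth_succ_cons, Fin.cons_zero, Fin.cons_succ,
          Fin.val_zero, Fin.val_succ, pow_succ _ (_ + 1), zero_add, pow_one,
          mul_neg, mul_one, neg_smul, one_smul, Finset.sum_neg_distrib]
        abel
      have h2 : ∑ s : G, Finsupp.single g (M.ρ s⁻¹ (θ (M.ρ s m))) = Finsupp.single g m := by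
        refine (map_sum (Finsupp.lsingle (R := k) g) _ _).symm.trans (congrArg _ ?_)
        exact (Fintype.sum_equiv (Equiv.inv G) _ _ fun s => by simp).trans (hθ m)
      have h3 : ∑ s : G, Finsupp.single (Fin.cons (s * g 0) fun i => g i.succ : Fin (n + 1) → G)
            (θ (M.ρ s m)) =
          ∑ s : G, Finsupp.single (Fin.cons s fun i => g i.succ : Fin (n + 1) → G)
            (θ (M.ρ s (M.ρ (g 0)⁻¹ m))) :=
        Fintype.sum_equiv (Equiv.mulRight (g 0)) _ _ fun s => by simp
      rw [hs, map_sum, Finset.sum_congr rfl fun s _ => h1 s, Finset.sum_sub_distrib,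
        Finset.sum_sub_distrib, h2, h3, inhomogeneousChains.d_single, map_add, map_sum, hs,
        Finset.sum_comm]
      simp only [map_smul, hs, Finset.smul_sum]
      abel
  exact ⟨h (n + 1) f, by have := key f; rwa [hf, map_zero, add_zero] at this⟩

lemma isZero_of_exact (i n j : ℤ) (hi : i + 1 = n) (hj : n + 1 = j)
    (h : ∀ x : (tateComplex M).X n, (tateComplex M).d n j x = 0 →
      ∃ y : (tateComplex M).X i, (tateComplex M).d i n y = x) :
    Limits.IsZero (tateCohomology M n) := by
  refine HomologicalComplex.ExactAt.isZero_homology (K := tateComplex M) ?_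
  rw [HomologicalComplex.exactAt_iff' _ i n j (by simp [← hi]) (by simpa using hj),
    ShortComplex.moduleCat_exact_iff]
  exact h

/-- A `G`-module whose identity is the norm of a linear endomorphism has no Tate cohomology. -/
lemma isZero_of_norm (hθ : ∀ m, ∑ s : G, M.ρ s (θ (M.ρ s⁻¹ m)) = m)
    (n : ℤ) : Limits.IsZero (tateCohomology M n) := by
  have hθ' : ∀ m, ∑ s : G, M.ρ s⁻¹ (θ (M.ρ s m)) = m := fun m =>
    (Fintype.sum_equiv (Equiv.inv G) _ _ fun s => by simp).trans (hθ m)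
  obtain ((_ | n) | (_ | _ | n)) := n
  · refine isZero_of_exact (-1) 0 1 rfl rfl fun (x : (Fin 0 → G) → M) hx => ?_
    change inhomogeneousCochains.d M 0 x = 0 at hx
    have hx' (s : G) : M.ρ s (x default) = x default := by
      have h : inhomogeneousCochains.d M 0 x (fun _ => s) = (0 : M) := congrFun hx _
      rw [inhomogeneousCochains.d_hom_apply] at h
      simp only [Fin.sum_univ_succ, Finset.univ_eq_empty, Finset.sum_empty, add_zero,
        Fin.val_zero, zero_add, pow_one, neg_smul, one_smul,
        Subsingleton.elim _ (default : Fin 0 → G)] at h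
      rwa [← sub_eq_add_neg, sub_eq_zero] at h
    refine ⟨(Finsupp.single default (θ (x default)) : (Fin 0 → G) →₀ M), ?_⟩
    change M.tateNorm (Finsupp.single default (θ (x default)) : (Fin 0 → G) →₀ M) = x
    rw [Rep.tateNorm_eq]
    funext g
    rw [Subsingleton.elim g default]
    refine Eq.trans ?_ (hθ (x default))
    simp [Representation.norm, hx']
  · refine isZero_of_exact (Int.ofNat n) (Int.ofNat (n + 1)) (Int.ofNat (n + 2)) rfl rfl
      fun (x : (Fin (n + 1) → G) → M) hx => ?_
    change (inhomogeneousCochains M).d (n + 1) (n + 2) x = 0 at hx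
    change ∃ y : (inhomogeneousCochains M).X n, (inhomogeneousCochains M).d n (n + 1) y = x
    rw [inhomogeneousCochains.d_def] at hx ⊢
    exact exists_cochain hθ n x hx
  · refine isZero_of_exact (Int.negSucc 1) (Int.negSucc 0) 0 rfl rfl fun (x : (Fin 0 → G) →₀ M) hx => ?_
    change M.tateNorm x = 0 at hx
    obtain ⟨m, rfl⟩ : ∃ m : M, x = Finsupp.single default m :=
      ⟨x default, Finsupp.unique_ext (by simp)⟩
    have hm : ∑ s : G, M.ρ s m = 0 := by
      rw [Rep.tateNorm_eq] at hx
      refine Eq.trans ?_ (congrFun hx default)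
      simp [Representation.norm]
    have h1 (s : G) (a : M) : inhomogeneousChains.d M 0
        (Finsupp.single (fun _ => s : Fin (0 + 1) → G) a) =
        Finsupp.lsingle (R := k) (default : Fin 0 → G) (M.ρ s⁻¹ a) -
        Finsupp.lsingle (R := k) (default : Fin 0 → G) a := by
      rw [inhomogeneousChains.d_single]
      simp [Subsingleton.elim _ (default : Fin 0 → G), sub_eq_add_neg]
    refine ⟨(∑ s : G, Finsupp.single (fun _ => s) (θ (M.ρ s m)) : (Fin (0 + 1) → G) →₀ M), ?_⟩
    change inhomogeneousChains.d M 0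
      (∑ s : G, Finsupp.single (fun _ => s) (θ (M.ρ s m)) : (Fin (0 + 1) → G) →₀ M) = _
    rw [map_sum, Finset.sum_congr rfl fun s _ => h1 s _, Finset.sum_sub_distrib, ← map_sum,
      ← map_sum, hθ', ← map_sum, hm]
    simp
  · refine isZero_of_exact (-3) (-2) (-1) rfl rfl fun (x : (Fin 1 → G) →₀ M) hx => ?_
    change (inhomogeneousChains M).d 1 0 x = 0 at hx
    change ∃ y : (inhomogeneousChains M).X 2, (inhomogeneousChains M).d 2 1 y = x
    rw [inhomogeneousChains.d_def] at hx ⊢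
    exact exists_chain hθ 0 x hx
  · refine isZero_of_exact (Int.negSucc (n + 3)) (Int.negSucc (n + 2)) (Int.negSucc (n + 1))
      rfl rfl fun (x : (Fin (n + 2) → G) →₀ M) hx => ?_
    replace hx : (inhomogeneousChains M).d (n + 2) (n + 1) x = 0 := by
      exact hx
    have : ∃ y : (inhomogeneousChains M).X (n + 3), (inhomogeneousChains M).d (n + 3) (n + 2) y = x := by
      rw [inhomogeneousChains.d_def] at hx ⊢
      exact exists_chain hθ (n + 1) x hx
    exact this

lemma isZero_ind (A : Rep.{u} k G) (n : ℤ) : Limits.IsZero (tateCohomology (ind A) n) := by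
  classical
  refine isZero_of_norm (M := ind A)
    (θ := (LinearMap.single k (fun _ : G => A) 1) ∘ₗ LinearMap.proj 1) (fun f => ?_) n
  funext x
  rw [Finset.sum_apply, Finset.sum_eq_single x]
  · simp
  · intro s _ hs
    have : s⁻¹ * x ≠ 1 := fun h => hs (inv_mul_eq_one.1 h)
    simp [Pi.single_eq_of_ne this]
  · simp

end Vanishing


/-- The connecting isomorphism `Ĥⁿ(G, up A) ≃ Ĥⁿ⁺¹(G, A)`. -/
noncomputable def upEquiv (A : Rep.{u} k G) (n m : ℤ) (h : n + 1 = m) :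
    tateCohomology (up A) n ≃ₗ[k] tateCohomology A m :=
  have := (TateCohomology.map_tateComplexFunctor_shortExact (upSeq_exact A)).isIso_δ n m h
    (isZero_ind A n) (isZero_ind A m)
  (asIso ((TateCohomology.map_tateComplexFunctor_shortExact
    (upSeq_exact A)).δ n m h)).toLinearEquiv

/-- The connecting isomorphism `Ĥⁿ(G, A) ≃ Ĥⁿ⁺¹(G, down A)`. -/
noncomputable def downEquiv (A : Rep.{u} k G) (n m : ℤ) (h : n + 1 = m) :
    tateCohomology A n ≃ₗ[k] tateCohomology (down A) m :=
  have := (TateCohomology.map_tateComplexFunctor_shortExact (downSeq_exact A)).isIso_δ n m h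
    (isZero_ind A n) (isZero_ind A m)
  (asIso ((TateCohomology.map_tateComplexFunctor_shortExact
    (downSeq_exact A)).δ n m h)).toLinearEquiv

/-- The `0`-cocycle of the Tate complex given by an invariant element. -/
noncomputable def cocycle0 (A : Rep.{u} k G) :
    ModuleCat.of k A.ρ.invariants ⟶ (tateComplex A).cycles 0 :=
  (tateComplex A).liftCycles
    (ModuleCat.ofHom (LinearMap.pi fun _ : Fin 0 → G => A.ρ.invariants.subtype) :
      ModuleCat.of k A.ρ.invariants ⟶ (tateComplex A).X 0) 1 (by simp) (by
        ext a
        funext g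
        change inhomogeneousCochains.d A 0 (fun _ => a.1) g = (0 : A)
        rw [inhomogeneousCochains.d_hom_apply]
        simp [a.2 (g 0)])

/-- The class `[a] ∈ Ĥ⁰(G, A)` of an invariant element `a ∈ Aᴳ`. -/
noncomputable def class0 (A : Rep.{u} k G) : A.ρ.invariants →ₗ[k] tateCohomology A 0 :=
  (cocycle0 A ≫ (tateComplex A).homologyπ 0).hom

lemma iCycles_cocycle0 (A : Rep.{u} k G) (a : A.ρ.invariants) :
    (tateComplex A).iCycles 0 (cocycle0 A a) = (fun _ => a.1 : (Fin 0 → G) → A) := by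
  have h : cocycle0 A ≫ (tateComplex A).iCycles 0 = _ :=
    HomologicalComplex.liftCycles_i _ _ _ _ _
  exact congrArg (fun f => f.hom a) h

lemma iCycles_injective (A : Rep.{u} k G) (n : ℤ) :
    Function.Injective ((tateComplex A).iCycles n) :=
  (ModuleCat.mono_iff_injective _).1 inferInstance

lemma class0_surjective (A : Rep.{u} k G) : Function.Surjective (class0 A) := by
  intro b
  obtain ⟨z, rfl⟩ := (ModuleCat.epi_iff_surjective ((tateComplex A).homologyπ 0)).1 inferInstance b
  obtain ⟨x, hx⟩ : ∃ x : (Fin 0 → G) → A, (tateComplex A).iCycles 0 z = x := ⟨_, rfl⟩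
  have hdx : inhomogeneousCochains.d A 0 x = 0 := by
    have h := congrArg (fun f => f.hom z) ((tateComplex A).iCycles_d 0 1)
    rw [← hx]
    exact h
  have hinv (s : G) : A.ρ s (x default) = x default := by
    have h : inhomogeneousCochains.d A 0 x (fun _ => s) = (0 : A) := congrFun hdx _
    rw [inhomogeneousCochains.d_hom_apply] at h
    simp only [Fin.sum_univ_succ, Finset.univ_eq_empty, Finset.sum_empty, add_zero,
      Fin.val_zero, zero_add, pow_one, neg_smul, one_smul,
      Subsingleton.elim _ (default : Fin 0 → G)] at h
    rwa [← sub_eq_add_neg, sub_eq_zero] at h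
  refine ⟨⟨x default, hinv⟩, congrArg ((tateComplex A).homologyπ 0) ?_⟩
  refine iCycles_injective A 0 ((iCycles_cocycle0 A ⟨x default, hinv⟩).trans (Eq.trans ?_ hx.symm))
  funext g
  rw [Subsingleton.elim g default]

lemma class0_eq_zero_iff (A : Rep.{u} k G) (a : A.ρ.invariants) :
    class0 A a = 0 ↔ ∃ b : A, A.ρ.norm b = a := by
  have hex : (ShortComplex.mk _ _ ((tateComplex A).toCycles_comp_homologyπ (Int.negSucc 0) 0)).Exact :=
    ShortComplex.exact_of_g_is_cokernel _
      ((tateComplex A).homologyIsCokernel (Int.negSucc 0) 0 (by simp))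
  have key (y : (Fin 0 → G) →₀ A) : (tateComplex A).toCycles (Int.negSucc 0) 0 y = cocycle0 A a ↔
      A.ρ.norm (y default) = a.1 := by
    rw [← (iCycles_injective A 0).eq_iff, iCycles_cocycle0]
    have h : (tateComplex A).iCycles 0 ((tateComplex A).toCycles (Int.negSucc 0) 0 y) = A.tateNorm y :=
      congrArg (fun f => f.hom y) ((tateComplex A).toCycles_i (Int.negSucc 0) 0)
    rw [h, Rep.tateNorm_eq]
    obtain ⟨m, rfl⟩ : ∃ m : A, y = Finsupp.single default m :=
      ⟨y default, Finsupp.unique_ext (by simp)⟩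
    refine ⟨fun h => ?_, fun h => funext fun g => ?_⟩
    · refine Eq.trans ?_ (congrFun h default)
      simp
    · refine Eq.trans ?_ h
      simp
  constructor
  · intro h
    obtain ⟨y, hy⟩ := (ShortComplex.moduleCat_exact_iff _).1 hex (cocycle0 A a) h
    exact ⟨_, (key y).1 hy⟩
  · rintro ⟨b, hb⟩
    have h := (key (Finsupp.single default b)).2 (by simpa using hb)
    refine (congrArg ((tateComplex A).homologyπ 0) h.symm).trans ?_
    exact congrArg (fun f => f.hom (Finsupp.single default b : (Fin 0 → G) →₀ A))
      ((tateComplex A).toCycles_comp_homologyπ (Int.negSucc 0) 0)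

lemma map_class0 {A B : Rep.{u} k G} (f : A ⟶ B) (a : A.ρ.invariants) :
    (tateCohomologyFunctor 0).map f (class0 A a) =
      class0 B ⟨f.hom a, fun g => by rw [← Rep.hom_comm_apply, a.2 g]⟩ := by
  have h := congrArg (fun f => f.hom (cocycle0 A a))
    (HomologicalComplex.homologyπ_naturality (tateComplex.map f) 0)
  refine h.trans (congrArg ((tateComplex B).homologyπ 0) (iCycles_injective B 0 ?_))
  refine Eq.trans ?_ (iCycles_cocycle0 B _).symm
  refine (congrArg (fun f => f.hom (cocycle0 A a))
    (HomologicalComplex.cyclesMap_i (tateComplex.map f) 0)).trans ?_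
  refine (congrArg ((tateComplex.map f).f 0) (iCycles_cocycle0 A a)).trans ?_
  rfl

/-- A `G`-equivariant bilinear map `A × B → C`, i.e. a `G`-homomorphism `A ⊗ B → C`. -/
structure Pairing (A B C : Rep.{u} k G) where
  /-- The underlying bilinear map. -/
  toLin : A →ₗ[k] B →ₗ[k] C
  equivariant (g : G) (a : A) (b : B) : toLin (A.ρ g a) (B.ρ g b) = C.ρ g (toLin a b)

namespace Pairing

variable {A B C : Rep.{u} k G}

/-- The pairing `A × up B → up C` induced by `(a, f) ↦ (x ↦ β(a, f(x)))`. -/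
def up (β : Pairing A B C) : Pairing A (Tate.up B) (Tate.up C) where
  toLin := LinearMap.flip <| Submodule.liftQ _
    (LinearMap.mk₂ k (fun (f : G → B) (a : A) =>
      (Submodule.Quotient.mk (fun x => β.toLin a (f x)) : Tate.up C))
      (fun f f' a => by simp; rfl) (fun c f a => by simp; rfl)
      (fun f a a' => by simp; rfl) (fun c f a => by simp; rfl)) (by
    rintro _ ⟨b, rfl⟩
    ext a
    exact (Submodule.Quotient.mk_eq_zero _).2 ⟨β.toLin a b, rfl⟩)
  equivariant g a b := by
    obtain ⟨f, rfl⟩ := Submodule.Quotient.mk_surjective _ b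
    refine congrArg Submodule.Quotient.mk (funext fun x => ?_)
    exact β.equivariant g a (f (g⁻¹ * x))

/-- The pairing `A × down B → down C`, `(a, f) ↦ (x ↦ β(a, f(x)))`. -/
def down (β : Pairing A B C) : Pairing A (Tate.down B) (Tate.down C) where
  toLin := LinearMap.mk₂ k (fun a f => ⟨fun x => β.toLin a (f.1 x), by
      have hf : (total B).hom f.1 = 0 := f.2
      change (total C).hom _ = 0
      rw [total_apply] at hf ⊢
      rw [← map_sum, hf, map_zero]⟩)
    (fun a a' f => by ext x; simp) (fun c a f => by ext x; simp)
    (fun a f f' => by ext x; simp) (fun c a f => by ext x; simp)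
  equivariant g a f := Subtype.ext (funext fun x => β.equivariant g a (f.1 (g⁻¹ * x)))

/-- The `G`-homomorphism `β(-, b) : A → C` defined by an invariant element `b`. -/
def right (β : Pairing A B C) (b : B.ρ.invariants) : A ⟶ C :=
  Rep.ofHom ⟨β.toLin.flip b.1, fun g => by
    ext a
    simpa [b.2 g] using β.equivariant g a b.1⟩

end Pairing


/-- The map induced by `f : A ⟶ B` on Tate cohomology. -/
noncomputable abbrev tateMap {A B : Rep.{u} k G} (f : A ⟶ B) (n : ℤ) :
    tateCohomology A n →ₗ[k] tateCohomology B n :=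
  ((tateCohomologyFunctor n).map f).hom

lemma tateComplex_map_smul {A B : Rep.{u} k G} (c : k) (f : A ⟶ B) :
    tateComplex.map (c • f) = c • tateComplex.map f := by
  apply HomologicalComplex.hom_ext
  intro i
  obtain (n | n) := i
  · rfl
  · apply ModuleCat.hom_ext
    refine Finsupp.lhom_ext fun g a => ?_
    change (groupHomology.chainsMap (MonoidHom.id G) (c • f)).f n (Finsupp.single g a) =
      c • (groupHomology.chainsMap (MonoidHom.id G) f).f n (Finsupp.single g a)
    simp [Rep.smul_hom]

lemma tateMap_smul {A B : Rep.{u} k G} (c : k) (f : A ⟶ B) (n : ℤ) :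
    tateMap (c • f) n = c • tateMap f n := by
  have h : (tateCohomologyFunctor n).map (c • f) = c • (tateCohomologyFunctor n).map f := by
    change HomologicalComplex.homologyMap (tateComplex.map (c • f)) n = _
    rw [tateComplex_map_smul]
    exact ShortComplex.homologyMap_smul
      ((HomologicalComplex.shortComplexFunctor _ _ n).map (tateComplex.map f)) c
  exact congrArg ModuleCat.Hom.hom h

lemma tateMap_add {A B : Rep.{u} k G} (f g : A ⟶ B) (n : ℤ) :
    tateMap (f + g) n = tateMap f n + tateMap g n := by
  have h : (tateCohomologyFunctor n).map (f + g) =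
      (tateCohomologyFunctor n).map f + (tateCohomologyFunctor n).map g :=
    (tateComplexFunctor k G ⋙ HomologicalComplex.homologyFunctor _ _ n).map_add
  exact congrArg ModuleCat.Hom.hom h

/-- Transport along an equality of degrees. -/
noncomputable def degCast (A : Rep.{u} k G) {n m : ℤ} (h : n = m) :
    tateCohomology A n ≃ₗ[k] tateCohomology A m :=
  h ▸ LinearEquiv.refl k _

namespace Pairing

variable {A B C : Rep.{u} k G}

/-- If `b` is a norm then `β(-, b)` factors through an induced module. -/
lemma right_eq_of_norm (β : Pairing A B C) (b : B.ρ.invariants) (b' : B)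
    (hb : B.ρ.norm b' = b) : ∃ f : A ⟶ ind C, f ≫ total C = β.right b := by
  refine ⟨Rep.ofHom (σ := funRep C) ⟨LinearMap.pi fun x =>
    C.ρ x ∘ₗ β.toLin.flip b' ∘ₗ A.ρ x⁻¹, fun g => ?_⟩, ?_⟩
  · ext a x
    simp
  · ext a
    refine (total_apply C _).trans ?_
    change _ = β.toLin a b.1
    rw [← hb]
    simp only [Representation.norm, LinearMap.sum_apply, map_sum]
    refine Finset.sum_congr rfl fun x _ => ?_
    have := β.equivariant x (A.ρ x⁻¹ a) b'
    rw [← Module.End.mul_apply, ← map_mul, mul_inv_cancel, map_one] at this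
    exact this.symm

lemma tateMap_right_eq_zero (β : Pairing A B C) (b : B.ρ.invariants)
    (hb : class0 B b = 0) (p : ℤ) : tateMap (β.right b) p = 0 := by
  obtain ⟨b', hb'⟩ := (class0_eq_zero_iff B b).1 hb
  obtain ⟨f, hf⟩ := β.right_eq_of_norm b b' hb'
  rw [tateMap, ← hf, Functor.map_comp, (isZero_ind C p).eq_of_tgt ((tateCohomologyFunctor p).map f) 0]
  simp

/-- The map `Bᴳ → Hom(Ĥᵖ(G, A), Ĥᵖ(G, C))`, `b ↦ β(-, b)_*`. -/
noncomputable def cupInvariants (β : Pairing A B C) (p : ℤ) :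
    B.ρ.invariants →ₗ[k] tateCohomology A p →ₗ[k] tateCohomology C p where
  toFun b := tateMap (β.right b) p
  map_add' b b' := by
    rw [← tateMap_add]
    congr 1
    ext a
    exact map_add (β.toLin a) b.1 b'.1
  map_smul' c b := by
    rw [← tateMap_smul]
    congr 1
    ext a
    exact map_smul (β.toLin a) c b.1

/-- The cup product `Ĥᵖ(G, A) × Ĥ⁰(G, B) → Ĥᵖ(G, C)`, `a ∪ [b] = β(-, b)_* a`. -/
noncomputable def cupZero (β : Pairing A B C) (p : ℤ) :
    tateCohomology A p →ₗ[k] tateCohomology B 0 →ₗ[k] tateCohomology C p :=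
  LinearMap.flip <|
    (LinearMap.ker (class0 B)).liftQ (β.cupInvariants p)
      (fun b hb => β.tateMap_right_eq_zero b hb p) ∘ₗ
    ((class0 B).quotKerEquivOfSurjective (class0_surjective B)).symm.toLinearMap

lemma cupZero_class0 (β : Pairing A B C) (p : ℤ) (a : tateCohomology A p)
    (b : B.ρ.invariants) : β.cupZero p a (class0 B b) = tateMap (β.right b) p a := by
  have h : ((class0 B).quotKerEquivOfSurjective (class0_surjective B)).symm (class0 B b) =
      Submodule.Quotient.mk b := by
    rw [LinearEquiv.symm_apply_eq]
    rfl
  exact congrArg (fun z => (LinearMap.ker (class0 B)).liftQ (β.cupInvariants p)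
    (fun b hb => β.tateMap_right_eq_zero b hb p) z a) h

/-- The cup product `Ĥᵖ(G, A) × Ĥ^q(G, B) → Ĥᵖ⁺^q(G, C)` for `q = m ≥ 0`, by dimension shifting
in the second variable: `a ∪ δ b = (-1)ᵖ δ (a ∪ b)` for the connecting maps `δ` of
`0 → B → ind B → up B → 0` and `0 → C → ind C → up C → 0`. -/
noncomputable def cupNonneg : ∀ (m : ℕ) {A B C : Rep.{u} k G} (_ : Pairing A B C) (p q n : ℤ),
    q = m → p + q = n →
      (tateCohomology A p →ₗ[k] tateCohomology B q →ₗ[k] tateCohomology C n)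
  | 0, _, B, C, β, p, _, _, hq, hn =>
      ((β.cupZero p).compl₂ (degCast B hq).toLinearMap).compr₂
        (degCast C (by simpa [hq] using hn)).toLinearMap
  | m + 1, _, B, C, β, p, q, n, hq, hn =>
      p.negOnePow • ((cupNonneg m β.up p (q - 1) (n - 1) (by lia) (by lia)).compl₂
        (upEquiv B (q - 1) q (by lia)).symm.toLinearMap).compr₂
        (upEquiv C (n - 1) n (by lia)).toLinearMap

/-- The cup product `Ĥᵖ(G, A) × Ĥ^q(G, B) → Ĥᵖ⁺^q(G, C)` for `q = -m ≤ 0`, by dimension shifting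
in the second variable: `a ∪ δ b = (-1)ᵖ δ (a ∪ b)` for the connecting maps `δ` of
`0 → down B → ind B → B → 0` and `0 → down C → ind C → C → 0`. -/
noncomputable def cupNonpos : ∀ (m : ℕ) {A B C : Rep.{u} k G} (_ : Pairing A B C) (p q n : ℤ),
    q = -m → p + q = n →
      (tateCohomology A p →ₗ[k] tateCohomology B q →ₗ[k] tateCohomology C n)
  | 0, _, B, C, β, p, _, _, hq, hn =>
      ((β.cupZero p).compl₂ (degCast B (by simpa using hq)).toLinearMap).compr₂
        (degCast C (by simpa [hq] using hn)).toLinearMap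
  | m + 1, _, B, C, β, p, q, n, hq, hn =>
      p.negOnePow • ((cupNonpos m β.down p (q + 1) (n + 1) (by lia) (by lia)).compl₂
        (downEquiv B q (q + 1) rfl).toLinearMap).compr₂
        (downEquiv C n (n + 1) rfl).symm.toLinearMap

/-- The cup product `Ĥᵖ(G, A) × Ĥ^q(G, B) → Ĥⁿ(G, C)`, `n = p + q`, induced by a pairing
`A ⊗ B → C`: the family of bilinear maps that is determined by `a ∪ [b] = β(-, b)_* a` for `q = 0`
(so `[a] ∪ [b] = [β(a, b)]` for `p = q = 0`) and by the rule `a ∪ δ b = (-1)ᵖ δ (a ∪ b)` for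
connecting homomorphisms in the second variable. -/
noncomputable def cup (β : Pairing A B C) (p q n : ℤ) (hn : p + q = n) :
    tateCohomology A p →ₗ[k] tateCohomology B q →ₗ[k] tateCohomology C n :=
  match q, hn with
  | .ofNat m, hn => β.cupNonneg m p _ n rfl hn
  | .negSucc m, hn => β.cupNonpos (m + 1) p _ n rfl hn

/-- Composition `Hom(Y, Z) ⊗ Hom(X, Y) → Hom(X, Z)`, `f ⊗ φ ↦ f ∘ φ`. -/
def comp (X Y Z : Rep.{u} k G) :
    Pairing ((Rep.ihom Y).obj Z) ((Rep.ihom X).obj Y) ((Rep.ihom X).obj Z) where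
  toLin := LinearMap.llcomp k X Y Z
  equivariant g (f : Y →ₗ[k] Z) (φ : X →ₗ[k] Y) := by
    refine LinearMap.ext fun x => ?_
    change Z.ρ g (f (Y.ρ g⁻¹ (Y.ρ g (φ (X.ρ g⁻¹ x))))) = Z.ρ g (f (φ (X.ρ g⁻¹ x)))
    rw [← Module.End.mul_apply (Y.ρ g⁻¹), ← map_mul, inv_mul_cancel, map_one]
    rfl

end Pairing

/-- `Ĥⁿ(G, Hom(X, Y))`. -/
noncomputable abbrev HomCoh (X Y : Rep.{u} k G) (n : ℤ) : ModuleCat.{u} k :=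
  tateCohomology ((Rep.ihom X).obj Y) n

/-- The class `[id] ∈ Ĥ⁰(G, Hom(X, X))`. -/
noncomputable def idClass (X : Rep.{u} k G) : HomCoh X X 0 :=
  class0 ((Rep.ihom X).obj X) ⟨LinearMap.id, fun g => by
    refine LinearMap.ext fun x => ?_
    change X.ρ g (X.ρ g⁻¹ x) = x
    rw [← Module.End.mul_apply, ← map_mul, mul_inv_cancel, map_one]
    rfl⟩


/-- The ring `R = Ĥ⁰(G, Hom(X, X))` under the cup product. -/
def TateEnd (X : Rep.{u} k G) : Type u := HomCoh X X 0

namespace TateEnd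

variable (X : Rep.{u} k G)

noncomputable instance : AddCommGroup (TateEnd X) := inferInstanceAs (AddCommGroup (HomCoh X X 0))

noncomputable instance : Mul (TateEnd X) := ⟨fun a b => (Pairing.comp X X X).cup 0 0 0 rfl a b⟩

noncomputable instance : One (TateEnd X) := ⟨idClass X⟩

variable {X}

/-- The class of an equivariant endomorphism. -/
noncomputable def mk (f : ((Rep.ihom X).obj X).ρ.invariants) : TateEnd X := class0 _ f

lemma mk_surjective : Function.Surjective (mk (X := X)) := class0_surjective _

lemma one_def : (1 : TateEnd X) = idClass X := rfl

lemma mul_def (a b : TateEnd X) : a * b = (Pairing.comp X X X).cup 0 0 0 rfl a b := rfl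

/-- The composite of two equivariant endomorphisms. -/
def compInv (f g : ((Rep.ihom X).obj X).ρ.invariants) : ((Rep.ihom X).obj X).ρ.invariants :=
  ⟨(f.1 : X →ₗ[k] X) ∘ₗ (g.1 : X →ₗ[k] X), fun s => by
    refine ((Pairing.comp X X X).equivariant s f.1 g.1).symm.trans ?_
    rw [f.2 s, g.2 s]
    rfl⟩

/-- In degree `0` the cup product is composition. -/
lemma mk_mul_mk (f g : ((Rep.ihom X).obj X).ρ.invariants) : mk f * mk g = mk (compInv f g) :=
  ((Pairing.comp X X X).cupZero_class0 0 _ g).trans (map_class0 _ f)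

noncomputable instance : Ring (TateEnd X) where
  __ := (inferInstance : AddCommGroup (TateEnd X))
  left_distrib a b c := map_add ((Pairing.comp X X X).cup 0 0 0 rfl a) b c
  right_distrib a b c := congrArg (fun L : HomCoh X X 0 →ₗ[k] HomCoh X X 0 => L c)
    (map_add ((Pairing.comp X X X).cup 0 0 0 rfl) a b)
  zero_mul a := congrArg (fun L : HomCoh X X 0 →ₗ[k] HomCoh X X 0 => L a)
    (map_zero ((Pairing.comp X X X).cup 0 0 0 rfl))
  mul_zero a := map_zero ((Pairing.comp X X X).cup 0 0 0 rfl a)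
  mul_assoc a b c := by
    obtain ⟨f, rfl⟩ := mk_surjective a
    obtain ⟨g, rfl⟩ := mk_surjective b
    obtain ⟨h, rfl⟩ := mk_surjective c
    simp only [mk_mul_mk]
    rfl
  one_mul a := by
    obtain ⟨f, rfl⟩ := mk_surjective a
    exact mk_mul_mk _ f
  mul_one a := by
    obtain ⟨f, rfl⟩ := mk_surjective a
    exact mk_mul_mk f _

end TateEnd

/-- `(X, X')` is an `r`-encoding pair: for some `i` there is a natural isomorphism
`Ĥⁱ(G, Hom(X, -)) ≅ Ĥⁱ⁺ʳ(G, Hom(X', -))` of functors on `G`-modules. -/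
def IsEncodingPair (r : ℤ) (X X' : Rep.{u} k G) : Prop :=
  ∃ i : ℤ, Nonempty
    (Rep.ihom X ⋙ tateCohomologyFunctor i ≅ Rep.ihom X' ⋙ tateCohomologyFunctor (i + r))

/-- `x ∈ Ĥʳ(G, Hom(X', X))` and `x' ∈ Ĥ⁻ʳ(G, Hom(X, X'))` are mutually inverse:
`x' ∪ x = [id_{X'}]` and `x ∪ x' = [id_X]`. -/
def IsEncodingDecoding {r : ℤ} {X X' : Rep.{u} k G} (x : HomCoh X' X r) (x' : HomCoh X X' (-r)) :
    Prop :=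
  (Pairing.comp X' X X').cup (-r) r 0 (neg_add_cancel r) x' x = idClass X' ∧
    (Pairing.comp X X' X).cup r (-r) 0 (add_neg_cancel r) x x' = idClass X

/-- Encoding elements. -/
def IsEncodingElement {r : ℤ} {X X' : Rep.{u} k G} (x : HomCoh X' X r) : Prop :=
  ∃ x' : HomCoh X X' (-r), IsEncodingDecoding x x'

/-- The left action of `R = Ĥ⁰(G, Hom(X, X))` on `Ĥʳ(G, Hom(X', X))` by cup product. -/
noncomputable def TateEnd.act {r : ℤ} {X X' : Rep.{u} k G} (φ : TateEnd X) (x : HomCoh X' X r) :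
    HomCoh X' X r :=
  (Pairing.comp X' X X).cup 0 r r (zero_add r) φ x

end Tate

/-!
Encoding elements are the isomorphisms of degree `r` in the graded category whose objects are the
`G`-modules and whose morphisms of degree `n` from `W` to `Y` are the elements of
`Ĥⁿ(G, Hom(W, Y))`, composed by the cup product. Once the cup product is known to be associative
with two-sided units `[id]`, the theorem is the general fact that the isomorphisms `X' → X` form a
torsor under the automorphisms of `X`: if `x'` is inverse to `x`, then `y ∪ x'` is the unique
element of `Ĥ⁰(G, Hom(X, X))` that carries `x` to `y`, and `x' ∪ φ⁻¹` is inverse to `φ ∪ x`.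

The cup product is defined by dimension shifting in the second variable, upwards from degree `0`
along `0 → B → ind B → up B → 0` and downwards along `0 → down B → ind B → B → 0`. Associativity
(`Pairing.cup_assoc`) is proved by dimension shifting in the third variable. The degree of the inner
product `b ∪ c` may have the opposite sign to that of `c`, so this needs the rule
`a ∪ δ b = (-1)ᵖ δ (a ∪ b)` for both sequences in all degrees (`Pairing.cup_upEquiv`,
`Pairing.cup_downEquiv`), whereas the definition gives it for each sequence only on one side of `0`.

Both sequences split over the ground ring, and this yields morphisms of sequences
`downSeq B ⟶ upSeq (down B)`, the identity on `down B`, and `downSeq (up B) ⟶ upSeq B`, the identity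
on `up B`. They express each connecting isomorphism through the other one and a map of coefficients
(`downEquiv_eq`, `upEquiv_eq`). As these maps of coefficients commute with pairings, and the cup
product is natural in the second variable (`Pairing.tateMap_cup`), the rule extends to all degrees.
-/

namespace Tate

open CategoryTheory

universe u

variable {k G : Type u} [CommRing k] [Group G]

/-! ### Functoriality of the dimension-shifting sequences -/

/-- The map `f ∘ -` from `ind B` to `ind C`. -/
def indMap {B C : Rep.{u} k G} (f : B ⟶ C) : ind B ⟶ ind C :=
  Rep.ofHom (σ := funRep C) (ρ := funRep B)
    ⟨LinearMap.pi fun x => f.hom.toLinearMap ∘ₗ LinearMap.proj x, fun g => by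
      refine LinearMap.ext fun F => funext fun x => ?_
      exact Rep.hom_comm_apply f g (F (g⁻¹ * x))⟩

/-- The map `up B ⟶ up C` induced by `f : B ⟶ C`. -/
def upMap {B C : Rep.{u} k G} (f : B ⟶ C) : up B ⟶ up C :=
  Rep.ofHom ⟨Submodule.mapQ _ _ (indMap f).hom.toLinearMap (by
      rintro _ ⟨b, rfl⟩
      exact ⟨f.hom b, rfl⟩), fun g => by
    refine LinearMap.ext fun z => ?_
    obtain ⟨F, rfl⟩ := Submodule.Quotient.mk_surjective _ z
    exact congrArg Submodule.Quotient.mk (Rep.hom_comm_apply (indMap f) g F)⟩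

/-- The morphism `upSeq B ⟶ upSeq C` induced by `f : B ⟶ C`. -/
def upSeqMap {B C : Rep.{u} k G} (f : B ⟶ C) : upSeq B ⟶ upSeq C where
  τ₁ := f
  τ₂ := indMap f
  τ₃ := upMap f
  comm₁₂ := rfl
  comm₂₃ := rfl

/-- The linear section `[f] ↦ (y ↦ f y - f x)` of `ind B → up B`. -/
def upSection (B : Rep.{u} k G) (x : G) : up B →ₗ[k] ind B :=
  Submodule.liftQ _
    ({ toFun := fun f y => f y - f x
       map_add' := fun _ _ => funext fun _ => add_sub_add_comm _ _ _ _
       map_smul' := fun c f => funext fun y => (smul_sub c (f y) (f x)).symm } :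
      (G → B) →ₗ[k] G → B) (by
    rintro _ ⟨b, rfl⟩
    refine funext fun y => ?_
    change b - b = 0
    exact sub_self b)

lemma mk_upSection (B : Rep.{u} k G) (x : G) (z : up B) :
    Submodule.Quotient.mk (upSection B x z) = z := by
  obtain ⟨f, rfl⟩ := Submodule.Quotient.mk_surjective _ z
  refine (Submodule.Quotient.eq _).2 ⟨-f x, funext fun y => ?_⟩
  change -f x = (f y - f x) - f y
  abel

lemma upSection_ρ (B : Rep.{u} k G) (g x : G) (z : up B) :
    upSection B x ((up B).ρ g z) = (ind B).ρ g (upSection B (g⁻¹ * x) z) := by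
  obtain ⟨f, rfl⟩ := Submodule.Quotient.mk_surjective _ z
  refine funext fun y => ?_
  exact (map_sub (B.ρ g) _ _).symm

variable [Fintype G]

/-- The map `down B ⟶ down C` induced by `f : B ⟶ C`. -/
def downMap {B C : Rep.{u} k G} (f : B ⟶ C) : down B ⟶ down C :=
  Rep.ofHom ⟨(indMap f).hom.toLinearMap.restrict (by
      intro F hF
      have hF' : (total B).hom F = 0 := hF
      change (total C).hom _ = 0
      rw [total_apply] at hF' ⊢
      exact (map_sum f.hom _ _).symm.trans ((congrArg f.hom hF').trans (map_zero f.hom))),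
    fun g => by
    refine LinearMap.ext fun F => Subtype.ext ?_
    exact Rep.hom_comm_apply (indMap f) g F.1⟩

/-- The morphism `downSeq B ⟶ downSeq C` induced by `f : B ⟶ C`. -/
def downSeqMap {B C : Rep.{u} k G} (f : B ⟶ C) : downSeq B ⟶ downSeq C where
  τ₁ := downMap f
  τ₂ := indMap f
  τ₃ := f
  comm₁₂ := rfl
  comm₂₃ := by
    ext F
    refine (total_apply C _).trans (Eq.trans ?_ (congrArg f.hom (total_apply B F)).symm)
    exact (map_sum f.hom _ _).symm

/-- Naturality of the connecting homomorphism in Tate cohomology, for arbitrary consecutive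
degrees. -/
lemma tateMap_δ {S T : ShortComplex (Rep.{u} k G)} (hS : S.ShortExact) (hT : T.ShortExact)
    (φ : S ⟶ T) (n m : ℤ) (h : n + 1 = m) (z : tateCohomology S.X₃ n) :
    tateMap φ.τ₁ m ((TateCohomology.map_tateComplexFunctor_shortExact hS).δ n m h z) =
      (TateCohomology.map_tateComplexFunctor_shortExact hT).δ n m h (tateMap φ.τ₃ n z) :=
  congrArg (fun f => f.hom z) (HomologicalComplex.HomologySequence.δ_naturality
    ((tateComplexFunctor k G).mapShortComplex.map φ)
    (TateCohomology.map_tateComplexFunctor_shortExact hS)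
    (TateCohomology.map_tateComplexFunctor_shortExact hT) n m h)

lemma tateMap_id (A : Rep.{u} k G) (n : ℤ) (z : tateCohomology A n) : tateMap (𝟙 A) n z = z :=
  congrArg (fun f => f.hom z) ((tateCohomologyFunctor n).map_id A)

lemma tateMap_comp {A B C : Rep.{u} k G} (f : A ⟶ B) (g : B ⟶ C) (n : ℤ)
    (z : tateCohomology A n) : tateMap (f ≫ g) n z = tateMap g n (tateMap f n z) :=
  congrArg (fun f => f.hom z) ((tateCohomologyFunctor n).map_comp f g)

lemma tateMap_upEquiv {B C : Rep.{u} k G} (f : B ⟶ C) (n m : ℤ) (h : n + 1 = m)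
    (z : tateCohomology (up B) n) :
    tateMap f m (upEquiv B n m h z) = upEquiv C n m h (tateMap (upMap f) n z) :=
  tateMap_δ (upSeq_exact B) (upSeq_exact C) (upSeqMap f) n m h z

lemma tateMap_downEquiv {B C : Rep.{u} k G} (f : B ⟶ C) (n m : ℤ) (h : n + 1 = m)
    (z : tateCohomology B n) :
    tateMap (downMap f) m (downEquiv B n m h z) = downEquiv C n m h (tateMap f n z) :=
  tateMap_δ (downSeq_exact B) (downSeq_exact C) (downSeqMap f) n m h z

/-! ### Comparison of the two connecting isomorphisms -/

/-- The map `B ⟶ up (down B)`, `b ↦ [x ↦ single 1 b - single x b]`. -/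
def toUpDown [DecidableEq G] (B : Rep.{u} k G) : B ⟶ up (down B) :=
  Rep.ofHom ⟨Submodule.mkQ _ ∘ₗ (LinearMap.pi fun x =>
      (LinearMap.single k (fun _ : G => B) 1 - LinearMap.single k (fun _ : G => B) x).codRestrict
        (LinearMap.ker (total B).hom.toLinearMap) (fun b => by
          change (total B).hom _ = 0
          rw [total_apply]
          simp) : B →ₗ[k] ind (down B)), fun g => by
    refine LinearMap.ext fun b => ?_
    -- `single 1 (g b) - single x (g b)` and `single g (g b) - single x (g b)` differ by a constant
    -- function of `x`.
    refine (Submodule.Quotient.eq _).2 ⟨⟨Pi.single 1 (B.ρ g b) - Pi.single g (B.ρ g b), ?_⟩, ?_⟩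
    · change (total B).hom _ = 0
      rw [total_apply]
      simp
    · refine funext fun x => Subtype.ext (funext fun y => ?_)
      change (Pi.single 1 (B.ρ g b) - Pi.single g (B.ρ g b) : G → B) y =
        (Pi.single 1 (B.ρ g b) - Pi.single x (B.ρ g b) : G → B) y -
        B.ρ g ((Pi.single 1 b - Pi.single (g⁻¹ * x) b : G → B) (g⁻¹ * y))
      simp only [Pi.sub_apply, Pi.single_apply, map_sub, apply_ite (B.ρ g), map_zero,
        inv_mul_eq_one, mul_right_inj, eq_comm (a := g)]
      abel⟩

/-- The map `ind B ⟶ ind (down B)`, `F ↦ (x ↦ F - single x (∑ F))`. -/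
def indToIndDown [DecidableEq G] (B : Rep.{u} k G) : ind B ⟶ ind (down B) :=
  Rep.ofHom (σ := funRep (down B)) (ρ := funRep B) ⟨
    { toFun F x := ⟨fun y => F y - (Pi.single x (∑ z, F z) : G → B) y, by
        change (total B).hom _ = 0
        rw [total_apply]
        simp⟩
      map_add' F F' := funext fun x => Subtype.ext (funext fun y => by
        change (F y + F' y) - (Pi.single x (∑ z, (F z + F' z)) : G → B) y =
          (F y - (Pi.single x (∑ z, F z) : G → B) y) +
            (F' y - (Pi.single x (∑ z, F' z) : G → B) y)
        rw [Finset.sum_add_distrib, Pi.single_add, Pi.add_apply, add_sub_add_comm])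
      map_smul' c F := funext fun x => Subtype.ext (funext fun y => by
        change c • F y - (Pi.single x (∑ z, c • F z) : G → B) y =
          c • (F y - (Pi.single x (∑ z, F z) : G → B) y)
        rw [← Finset.smul_sum, Pi.single_smul, Pi.smul_apply, smul_sub]) }, fun g => by
    refine LinearMap.ext fun F => funext fun x => Subtype.ext (funext fun y => ?_)
    have hF : ∑ z, B.ρ g (F (g⁻¹ * z)) = B.ρ g (∑ z, F z) := by
      rw [map_sum]
      exact Fintype.sum_equiv (Equiv.mulLeft g⁻¹) _ _ fun z => rfl
    change B.ρ g (F (g⁻¹ * y)) - (Pi.single x (∑ z, B.ρ g (F (g⁻¹ * z))) : G → B) y =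
      B.ρ g (F (g⁻¹ * y) - (Pi.single (g⁻¹ * x) (∑ z, F z) : G → B) (g⁻¹ * y))
    simp only [hF, Pi.single_apply, map_sub, apply_ite (B.ρ g), map_zero, mul_right_inj]⟩

/-- A morphism of short exact sequences that is the identity on `down B`. -/
def downSeqToUpSeq [DecidableEq G] (B : Rep.{u} k G) : downSeq B ⟶ upSeq (down B) where
  τ₁ := 𝟙 _
  τ₂ := indToIndDown B
  τ₃ := toUpDown B
  comm₁₂ := by
    ext F
    refine funext fun x => Subtype.ext (funext fun y => ?_)
    have hF : ∑ z, F.1 z = 0 := (total_apply B F.1).symm.trans F.2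
    change F.1 y = F.1 y - (Pi.single x (∑ z, F.1 z) : G → B) y
    rw [hF]
    simp
  comm₂₃ := by
    ext (F : G → B)
    have h : (total B).hom F = ∑ z, F z := total_apply B F
    refine (Submodule.Quotient.eq _).2
      ⟨⟨(F - Pi.single 1 (∑ z, F z) : G → B), ?_⟩, funext fun x => Subtype.ext (funext fun y => ?_)⟩
    · refine (total_apply B _).trans ?_
      simp
    · change F y - (Pi.single 1 (∑ z, F z) : G → B) y =
        (F y - (Pi.single x (∑ z, F z) : G → B) y) -
        ((Pi.single 1 ((total B).hom F) : G → B) y - (Pi.single x ((total B).hom F) : G → B) y)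
      rw [h]
      abel

/-- The connecting isomorphism of `downSeq B` in terms of that of `upSeq (down B)`. -/
lemma downEquiv_eq [DecidableEq G] (B : Rep.{u} k G) (n m : ℤ) (h : n + 1 = m)
    (z : tateCohomology B n) :
    downEquiv B n m h z = upEquiv (down B) n m h (tateMap (toUpDown B) n z) :=
  (tateMap_id _ _ _).symm.trans
    (tateMap_δ (downSeq_exact B) (upSeq_exact (down B)) (downSeqToUpSeq B) n m h z)

/-- The map `ind (up B) ⟶ ind B`, `F ↦ ∑ₓ sₓ (F x)` for the sections `sₓ` of `upSection`. -/
def indUpToInd (B : Rep.{u} k G) : ind (up B) ⟶ ind B :=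
  Rep.ofHom (σ := funRep B) (ρ := funRep (up B))
    ⟨∑ x, upSection B x ∘ₗ LinearMap.proj x, fun g => by
      refine LinearMap.ext fun F => ?_
      simp only [LinearMap.comp_apply, LinearMap.sum_apply, LinearMap.proj_apply, funRep_apply,
        map_sum]
      exact Fintype.sum_equiv (Equiv.mulLeft g⁻¹) _ _ fun x => upSection_ρ B g x _⟩

lemma indUpToInd_apply (B : Rep.{u} k G) (F : G → up B) :
    (indUpToInd B).hom F = ∑ x, upSection B x (F x) := by
  simp [indUpToInd]

lemma mk_indUpToInd (B : Rep.{u} k G) (F : G → up B) :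
    (Submodule.Quotient.mk ((indUpToInd B).hom F) : up B) = (total (up B)).hom F := by
  rw [indUpToInd_apply, total_apply]
  exact (map_sum (Submodule.mkQ _) _ _).trans
    (Finset.sum_congr rfl fun x _ => mk_upSection B x (F x))

/-- The map `down (up B) ⟶ B` that sends `F` to the constant value of the function
`∑ₓ sₓ (F x)`, for the sections `sₓ` of `upSection`. -/
def ofDownUp (B : Rep.{u} k G) : down (up B) ⟶ B :=
  Rep.ofHom ⟨LinearMap.proj 1 ∘ₗ (indUpToInd B).hom.toLinearMap ∘ₗ
      (LinearMap.ker (total (up B)).hom.toLinearMap).subtype, fun g => by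
    refine LinearMap.ext fun F => ?_
    have h0 : (total (up B)).hom F.1 = 0 := F.2
    obtain ⟨b, hb⟩ := (Submodule.Quotient.mk_eq_zero _).1 ((mk_indUpToInd B F.1).trans h0)
    change ((indUpToInd B).hom ((ind (up B)).ρ g F.1) : G → B) 1 =
      B.ρ g (((indUpToInd B).hom F.1 : G → B) 1)
    rw [Rep.hom_comm_apply, ← hb]
    rfl⟩

lemma ofDownUp_apply (B : Rep.{u} k G) (F : down (up B)) :
    (ofDownUp B).hom F = ∑ x, upSection B x (F.1 x) 1 :=
  (congrFun (indUpToInd_apply B F.1) 1).trans (Finset.sum_apply _ _ _)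

/-- A morphism of short exact sequences that is the identity on `up B`. -/
def downSeqUpToUpSeq (B : Rep.{u} k G) : downSeq (up B) ⟶ upSeq B where
  τ₁ := ofDownUp B
  τ₂ := indUpToInd B
  τ₃ := 𝟙 _
  comm₁₂ := by
    ext F
    have h0 : (total (up B)).hom F.1 = 0 := F.2
    obtain ⟨b, hb⟩ := (Submodule.Quotient.mk_eq_zero _).1 ((mk_indUpToInd B F.1).trans h0)
    change (fun _ => ((indUpToInd B).hom F.1 : G → B) 1) = (indUpToInd B).hom F.1
    rw [← hb]
    rfl
  comm₂₃ := by
    ext F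
    exact mk_indUpToInd B F

/-- The connecting isomorphism of `upSeq B` in terms of that of `downSeq (up B)`. -/
lemma upEquiv_eq (B : Rep.{u} k G) (n m : ℤ) (h : n + 1 = m) (z : tateCohomology (up B) n) :
    upEquiv B n m h z = tateMap (ofDownUp B) m (downEquiv (up B) n m h z) :=
  ((tateMap_δ (downSeq_exact (up B)) (upSeq_exact B) (downSeqUpToUpSeq B) n m h z).trans
    (congrArg _ (tateMap_id _ _ _))).symm

/-! ### Cup products and connecting isomorphisms -/

namespace Pairing

variable {A B C : Rep.{u} k G}

lemma cup_eq_cupNonneg (β : Pairing A B C) (m : ℕ) (p q n : ℤ) (hq : q = m) (hn : p + q = n) :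
    β.cup p q n hn = β.cupNonneg m p q n hq hn := by
  subst hq
  rfl

lemma cup_eq_cupNonpos (β : Pairing A B C) (m : ℕ) (p q n : ℤ) (hq : q = -m) (hn : p + q = n) :
    β.cup p q n hn = β.cupNonpos m p q n hq hn := by
  subst hq
  cases m <;> rfl

lemma cup_class0 (β : Pairing A B C) (p : ℤ) (a : tateCohomology A p) (b : B.ρ.invariants) :
    β.cup p 0 p (add_zero p) a (class0 B b) = tateMap (β.right b) p a :=
  β.cupZero_class0 p a b

/-- The defining rule of the cup product in nonnegative degrees. -/
lemma cup_upEquiv_of_nonneg (β : Pairing A B C) (p q n q' n' : ℤ) (h0 : 0 ≤ q) (hn : p + q = n)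
    (hq' : q + 1 = q') (hn' : n + 1 = n') (a : tateCohomology A p) (b : tateCohomology (Tate.up B) q) :
    β.cup p q' n' (by lia) a (upEquiv B q q' hq' b) =
      p.negOnePow • upEquiv C n n' hn' (β.up.cup p q n hn a b) := by
  obtain ⟨m, hm⟩ := Int.eq_ofNat_of_zero_le h0
  obtain rfl : n = n' - 1 := by lia
  obtain rfl : q = q' - 1 := by lia
  rw [β.cup_eq_cupNonneg (m + 1) p q' n' (by lia) (by lia),
    β.up.cup_eq_cupNonneg m p (q' - 1) (n' - 1) hm hn]
  change p.negOnePow • upEquiv C (n' - 1) n' _ (β.up.cupNonneg m p (q' - 1) (n' - 1) _ _ a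
    ((upEquiv B (q' - 1) q' _).symm (upEquiv B (q' - 1) q' _ b))) = _
  rw [LinearEquiv.symm_apply_apply]

/-- The defining rule of the cup product in negative degrees. -/
lemma cup_downEquiv_of_neg (β : Pairing A B C) (p q n q' n' : ℤ) (h0 : q < 0) (hn : p + q = n)
    (hq' : q + 1 = q') (hn' : n + 1 = n') (a : tateCohomology A p) (b : tateCohomology B q) :
    β.down.cup p q' n' (by lia) a (downEquiv B q q' hq' b) =
      p.negOnePow • downEquiv C n n' hn' (β.cup p q n hn a b) := by
  obtain ⟨m, hm⟩ : ∃ m : ℕ, q = -(m + 1 : ℕ) := ⟨(-q - 1).toNat, by lia⟩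
  subst hq' hn'
  rw [β.cup_eq_cupNonpos (m + 1) p q n hm hn,
    β.down.cup_eq_cupNonpos m p (q + 1) (n + 1) (by lia) (by lia)]
  change _ = p.negOnePow • downEquiv C n (n + 1) _ (p.negOnePow • (downEquiv C n (n + 1) _).symm
    (β.down.cupNonpos m p (q + 1) (n + 1) _ _ a (downEquiv B q (q + 1) _ b)))
  rw [Units.smul_def, Units.smul_def, map_zsmul, LinearEquiv.apply_symm_apply, smul_smul,
    Int.units_coe_mul_self, one_smul]

/-- The cup product is natural in the second variable. -/
lemma tateMap_cup {A B B' C C' : Rep.{u} k G} (β : Pairing A B C) (β' : Pairing A B' C')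
    (f : B ⟶ B') (g : C ⟶ C') (h : ∀ a b, g.hom (β.toLin a b) = β'.toLin a (f.hom b))
    (p q n : ℤ) (hn : p + q = n) (a : tateCohomology A p) (b : tateCohomology B q) :
    tateMap g n (β.cup p q n hn a b) = β'.cup p q n hn a (tateMap f q b) := by
  induction q using Int.induction_on generalizing B B' C C' n with
  | zero =>
    obtain rfl : p = n := by lia
    obtain ⟨b, rfl⟩ := class0_surjective B b
    rw [cup_class0, map_class0, cup_class0, ← tateMap_comp]
    refine congrArg (fun φ => tateMap φ p a) ?_
    ext a
    exact h a b.1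
  | succ m ih =>
    obtain ⟨b, rfl⟩ := (upEquiv B m (m + 1) rfl).surjective b
    obtain ⟨n, rfl⟩ : ∃ n', n = n' + 1 := ⟨n - 1, by lia⟩
    rw [β.cup_upEquiv_of_nonneg p m n (m + 1) (n + 1) (by lia) (by lia) rfl rfl, tateMap_upEquiv,
      β'.cup_upEquiv_of_nonneg p m n (m + 1) (n + 1) (by lia) (by lia) rfl rfl,
      Units.smul_def, Units.smul_def, map_zsmul, tateMap_upEquiv,
      ih β.up β'.up (upMap f) (upMap g)]
    intro a z
    obtain ⟨F, rfl⟩ := Submodule.Quotient.mk_surjective _ z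
    exact congrArg Submodule.Quotient.mk (funext fun x => h a (F x))
  | pred m ih =>
    have H := β'.cup_downEquiv_of_neg p (-m - 1) n (-m) (n + 1) (by lia) hn (by lia) rfl a
      (tateMap f _ b)
    rw [← tateMap_downEquiv, ← ih β.down β'.down (downMap f) (downMap g)
        (fun a F => Subtype.ext (funext fun x => h a (F.1 x))) (n + 1) (by lia),
      β.cup_downEquiv_of_neg p (-m - 1) n (-m) (n + 1) (by lia) hn (by lia) rfl,
      Units.smul_def, Units.smul_def, map_zsmul, tateMap_downEquiv, ← Units.smul_def,
      ← Units.smul_def, smul_left_cancel_iff] at H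
    exact (downEquiv C' n (n + 1) rfl).injective H

/-- The rule `a ∪ δ b = (-1)ᵖ δ (a ∪ b)` for the sequences `0 → B → ind B → up B → 0`. -/
lemma cup_upEquiv (β : Pairing A B C) (p q n q' n' : ℤ) (hn : p + q = n)
    (hq' : q + 1 = q') (hn' : n + 1 = n') (a : tateCohomology A p)
    (b : tateCohomology (Tate.up B) q) :
    β.cup p q' n' (by lia) a (upEquiv B q q' hq' b) =
      p.negOnePow • upEquiv C n n' hn' (β.up.cup p q n hn a b) := by
  rcases le_or_gt 0 q with h0 | h0
  · exact β.cup_upEquiv_of_nonneg p q n q' n' h0 hn hq' hn' a b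
  rw [upEquiv_eq, ← tateMap_cup β.up.down β (ofDownUp B) (ofDownUp C),
    β.up.cup_downEquiv_of_neg p q n q' n' h0 hn hq' hn', upEquiv_eq,
    Units.smul_def, Units.smul_def, map_zsmul]
  intro a F
  rw [ofDownUp_apply, ofDownUp_apply, map_sum]
  refine Finset.sum_congr rfl fun x _ => ?_
  change upSection C x (β.up.toLin a (F.1 x)) 1 = _
  obtain ⟨f, hf⟩ := Submodule.Quotient.mk_surjective _ (F.1 x)
  rw [← hf]
  exact (map_sub (β.toLin a) _ _).symm

/-- The rule `a ∪ δ b = (-1)ᵖ δ (a ∪ b)` for the sequences `0 → down B → ind B → B → 0`. -/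
lemma cup_downEquiv (β : Pairing A B C) (p q n q' n' : ℤ) (hn : p + q = n)
    (hq' : q + 1 = q') (hn' : n + 1 = n') (a : tateCohomology A p) (b : tateCohomology B q) :
    β.down.cup p q' n' (by lia) a (downEquiv B q q' hq' b) =
      p.negOnePow • downEquiv C n n' hn' (β.cup p q n hn a b) := by
  classical
  rcases lt_or_ge q 0 with h0 | h0
  · exact β.cup_downEquiv_of_neg p q n q' n' h0 hn hq' hn' a b
  rw [downEquiv_eq, β.down.cup_upEquiv_of_nonneg p q n q' n' h0 hn hq' hn', downEquiv_eq,
    tateMap_cup β β.down.up (toUpDown B) (toUpDown C)]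
  intro a b
  refine congrArg Submodule.Quotient.mk (funext fun x => Subtype.ext (funext fun y => ?_))
  change (Pi.single 1 (β.toLin a b) - Pi.single x (β.toLin a b) : G → C) y =
    β.toLin a ((Pi.single 1 b - Pi.single x b : G → B) y)
  simp only [Pi.sub_apply, Pi.single_apply, map_sub, apply_ite (β.toLin a), map_zero]

/-! ### Associativity and units -/

/-- The cup product is associative, for pairings that satisfy the same identity on coefficients. -/
lemma cup_assoc {A B C D E F : Rep.{u} k G} (β : Pairing A B D) (γ : Pairing D C E)
    (β' : Pairing B C F) (γ' : Pairing A F E)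
    (h : ∀ a b c, γ.toLin (β.toLin a b) c = γ'.toLin a (β'.toLin b c))
    (p q s i j n : ℤ) (hi : p + q = i) (hj : q + s = j) (hn : i + s = n) (hn' : p + j = n)
    (a : tateCohomology A p) (b : tateCohomology B q) (c : tateCohomology C s) :
    γ.cup i s n hn (β.cup p q i hi a b) c = γ'.cup p j n hn' a (β'.cup q s j hj b c) := by
  induction s using Int.induction_on generalizing C E F j n with
  | zero =>
    obtain rfl : i = n := by lia
    obtain rfl : q = j := by lia
    obtain ⟨c, rfl⟩ := class0_surjective C c
    rw [cup_class0, cup_class0]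
    exact tateMap_cup β γ' (β'.right c) (γ.right c) (fun a b => h a b c.1) p q i hi a b
  | succ m ih =>
    obtain ⟨c, rfl⟩ := (upEquiv C m (m + 1) rfl).surjective c
    obtain ⟨n, rfl⟩ : ∃ n', n = n' + 1 := ⟨n - 1, by lia⟩
    obtain ⟨j, rfl⟩ : ∃ j', j = j' + 1 := ⟨j - 1, by lia⟩
    rw [γ.cup_upEquiv i m n (m + 1) (n + 1) (by lia) rfl rfl,
      β'.cup_upEquiv q m j (m + 1) (j + 1) (by lia) rfl rfl,
      ih γ.up β'.up γ'.up _ j n (by lia) (by lia) (by lia),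
      Units.smul_def, Units.smul_def, map_zsmul,
      γ'.cup_upEquiv p j n (j + 1) (n + 1) (by lia) rfl rfl, ← Units.smul_def, ← Units.smul_def,
      smul_smul, ← Int.negOnePow_add, ← hi, add_comm p q]
    intro a b z
    obtain ⟨f, rfl⟩ := Submodule.Quotient.mk_surjective _ z
    exact congrArg Submodule.Quotient.mk (funext fun x => h a b (f x))
  | pred m ih =>
    -- The induction hypothesis for `δ c` is `δ` of the claim, up to the sign `(-1) ^ (p + q)` on both sides.
    have H := ih γ.down β'.down γ'.down
      (fun a b f => Subtype.ext (funext fun x => h a b (f.1 x))) (j + 1) (n + 1)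
      (by lia) (by lia) (by lia) (downEquiv C (-m - 1) (-m) (by lia) c)
    rw [γ.cup_downEquiv i (-m - 1) n (-m) (n + 1) hn (by lia) rfl,
      β'.cup_downEquiv q (-m - 1) j (-m) (j + 1) hj (by lia) rfl,
      Units.smul_def, Units.smul_def, map_zsmul,
      γ'.cup_downEquiv p j n (j + 1) (n + 1) hn' rfl rfl, ← Units.smul_def, ← Units.smul_def,
      smul_smul, ← Int.negOnePow_add, add_comm q p, hi, smul_left_cancel_iff] at H
    exact (downEquiv E n (n + 1) rfl).injective H

/-- An invariant element that acts as the identity is a left unit for the cup product. -/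
lemma class0_cup (β : Pairing A B B) (a : A.ρ.invariants) (h : ∀ b, β.toLin a.1 b = b)
    (q : ℤ) (b : tateCohomology B q) : β.cup 0 q q (zero_add q) (class0 A a) b = b := by
  induction q using Int.induction_on generalizing B with
  | zero =>
    obtain ⟨b, rfl⟩ := class0_surjective B b
    refine (β.cup_class0 0 _ b).trans ((map_class0 _ a).trans ?_)
    exact congrArg (class0 B) (Subtype.ext (h b.1))
  | succ m ih =>
    obtain ⟨b, rfl⟩ := (upEquiv B m (m + 1) rfl).surjective b
    rw [β.cup_upEquiv 0 m m (m + 1) (m + 1) (by lia) rfl rfl, Int.negOnePow_zero, one_smul,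
      ih β.up]
    intro z
    obtain ⟨f, rfl⟩ := Submodule.Quotient.mk_surjective _ z
    exact congrArg Submodule.Quotient.mk (funext fun x => h (f x))
  | pred m ih =>
    have H := ih β.down (fun f => Subtype.ext (funext fun x => h (f.1 x)))
      (downEquiv B (-m - 1) (-m) (by lia) b)
    rw [β.cup_downEquiv 0 (-m - 1) (-m - 1) (-m) (-m) (by lia) (by lia) (by lia),
      Int.negOnePow_zero, one_smul] at H
    exact (downEquiv B (-m - 1) (-m) (by lia)).injective H

/-- An invariant element that acts as the identity is a right unit for the cup product. -/
lemma cup_class0_of_eq (β : Pairing A B A) (b : B.ρ.invariants) (h : ∀ a, β.toLin a b.1 = a)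
    (p : ℤ) (a : tateCohomology A p) : β.cup p 0 p (add_zero p) a (class0 B b) = a := by
  rw [cup_class0, show β.right b = 𝟙 A from Rep.hom_ext (by ext a; exact h a), tateMap_id]

end Pairing

/-! ### Classes with coefficients in `Hom`-modules -/

section HomCoh

variable {W X Y Z : Rep.{u} k G}

lemma comp_cup_assoc (p q s i j n : ℤ) (hi : p + q = i) (hj : q + s = j) (hn : i + s = n)
    (hn' : p + j = n) (a : HomCoh Y Z p) (b : HomCoh X Y q) (c : HomCoh W X s) :
    (Pairing.comp W X Z).cup i s n hn ((Pairing.comp X Y Z).cup p q i hi a b) c =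
      (Pairing.comp W Y Z).cup p j n hn' a ((Pairing.comp W X Y).cup q s j hj b c) :=
  Pairing.cup_assoc _ _ _ _ (fun _ _ _ => rfl) p q s i j n hi hj hn hn' a b c

lemma idClass_cup (q : ℤ) (b : HomCoh X Y q) :
    (Pairing.comp X Y Y).cup 0 q q (zero_add q) (idClass Y) b = b :=
  Pairing.class0_cup _ _ (fun _ => rfl) q b

lemma cup_idClass (p : ℤ) (a : HomCoh X Y p) :
    (Pairing.comp X X Y).cup p 0 p (add_zero p) a (idClass X) = a :=
  Pairing.cup_class0_of_eq _ _ (fun _ => rfl) p a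

end HomCoh

namespace TateEnd

variable {r : ℤ} {X X' : Rep.{u} k G}

/-- The cup product `y ∪ x'` of `y ∈ Ĥʳ(G, Hom(X', X))` and `x' ∈ Ĥ⁻ʳ(G, Hom(X, X'))`, as an element
of the ring `Ĥ⁰(G, Hom(X, X))`. -/
noncomputable def ofCup (y : HomCoh X' X r) (x' : HomCoh X X' (-r)) : TateEnd X :=
  (Pairing.comp X X' X).cup r (-r) 0 (add_neg_cancel r) y x'

lemma ofCup_act (φ : TateEnd X) (x : HomCoh X' X r) (x' : HomCoh X X' (-r)) :
    ofCup (act φ x) x' = φ * ofCup x x' :=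
  comp_cup_assoc 0 r (-r) r 0 0 (zero_add r) (add_neg_cancel r) (add_neg_cancel r) rfl φ x x'

lemma act_ofCup (y : HomCoh X' X r) (x' : HomCoh X X' (-r)) (x : HomCoh X' X r) :
    act (ofCup y x') x = (Pairing.comp X' X' X).cup r 0 r (add_zero r) y
      ((Pairing.comp X' X X').cup (-r) r 0 (neg_add_cancel r) x' x) :=
  comp_cup_assoc r (-r) r 0 0 r (add_neg_cancel r) (neg_add_cancel r) (zero_add r) (add_zero r)
    y x' x

lemma act_act (φ ψ : TateEnd X) (x : HomCoh X' X r) : act φ (act ψ x) = act (φ * ψ) x :=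
  (comp_cup_assoc 0 0 r 0 r r rfl (zero_add r) (zero_add r) (zero_add r) φ ψ x).symm

lemma one_act (x : HomCoh X' X r) : act (1 : TateEnd X) x = x := idClass_cup r x

end TateEnd

namespace IsEncodingDecoding

variable {r : ℤ} {X X' : Rep.{u} k G} {x y : HomCoh X' X r} {x' y' : HomCoh X X' (-r)}

lemma ofCup_eq_one (hx : IsEncodingDecoding x x') : TateEnd.ofCup x x' = 1 := hx.2

/-- The class `y ∪ x'` carries `x` to `y`. -/
lemma act_ofCup_eq (hx : IsEncodingDecoding x x') (y : HomCoh X' X r) :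
    TateEnd.act (TateEnd.ofCup y x') x = y := by
  rw [TateEnd.act_ofCup, hx.1, cup_idClass]

/-- The ring `Ĥ⁰(G, Hom(X, X))` acts freely on an encoding element. -/
lemma act_injective (hx : IsEncodingDecoding x x') {φ ψ : TateEnd X}
    (h : TateEnd.act φ x = TateEnd.act ψ x) : φ = ψ := by
  rw [← mul_one φ, ← mul_one ψ, ← hx.ofCup_eq_one, ← TateEnd.ofCup_act, ← TateEnd.ofCup_act, h]

/-- If `x'` is inverse to `x`, then `x' ∪ φ⁻¹` is inverse to `φ ∪ x`. -/
lemma act_unit (hx : IsEncodingDecoding x x') (φ : (TateEnd X)ˣ) :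
    IsEncodingDecoding (TateEnd.act (φ : TateEnd X) x)
      ((Pairing.comp X X X').cup (-r) 0 (-r) (add_zero _) x' (φ⁻¹ : (TateEnd X)ˣ).val) := by
  constructor
  · refine (comp_cup_assoc (-r) 0 r (-r) r 0 (add_zero _) (zero_add r) (neg_add_cancel r)
      (neg_add_cancel r) x' (φ⁻¹ : (TateEnd X)ˣ).val (TateEnd.act (φ : TateEnd X) x)).trans ?_
    refine Eq.trans (congrArg _ ?_) hx.1
    refine (TateEnd.act_act _ _ x).trans ?_
    rw [Units.inv_mul, TateEnd.one_act]
  · refine (TateEnd.ofCup_act _ _ _).trans (Eq.trans (congrArg ((φ : TateEnd X) * ·) ?_) φ.mul_inv)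
    refine (comp_cup_assoc r (-r) 0 0 (-r) 0 (add_neg_cancel r) (add_zero _) rfl
      (add_neg_cancel r) x x' (φ⁻¹ : (TateEnd X)ˣ).val).symm.trans ?_
    rw [hx.2]
    exact idClass_cup 0 _

end IsEncodingDecoding

end Tate

theorem proposition3p4 {G : Type} [Group G] [Fintype G] (r : ℤ) (X X' : Rep.{0} ℤ G)
    (hX : Tate.IsEncodingPair r X X') :
    (∀ x y : Tate.HomCoh X' X r, Tate.IsEncodingElement x → Tate.IsEncodingElement y →
      ∃! φ : (Tate.TateEnd X)ˣ, y = Tate.TateEnd.act (φ : Tate.TateEnd X) x) ∧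
    (∀ x : Tate.HomCoh X' X r, Tate.IsEncodingElement x →
      ∀ φ : (Tate.TateEnd X)ˣ, Tate.IsEncodingElement (Tate.TateEnd.act (φ : Tate.TateEnd X) x)) := by
  refine ⟨?_, fun x ⟨x', hx⟩ φ => ⟨_, hx.act_unit φ⟩⟩
  rintro x y ⟨x', hx⟩ ⟨y', hy⟩
  refine ⟨⟨Tate.TateEnd.ofCup y x', Tate.TateEnd.ofCup x y', hy.act_injective ?_,
    hx.act_injective ?_⟩, (hx.act_ofCup_eq y).symm, fun φ hφ => Units.ext (hx.act_injective ?_)⟩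
  · rw [← Tate.TateEnd.act_act, Tate.TateEnd.one_act, hy.act_ofCup_eq x, hx.act_ofCup_eq y]
  · rw [← Tate.TateEnd.act_act, Tate.TateEnd.one_act, hx.act_ofCup_eq y, hy.act_ofCup_eq x]
  · exact hφ.symm.trans (hx.act_ofCup_eq y).symm
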